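/- Let $\rho$ be a probability measure on $\mathbb{R}$ that is even, has no atom at $0$, has variance one ($\int x^2\,d\rho(x)=1$) and satisfies $\int e^{tx}\,d\rho(x)<\infty$ for all real $t$. Fix $\beta\in(0,\infty)$. For each integer $N\ge 1$ let $K_{ij}$ $(1\le i<j\le N)$ be i.i.d. with law $\rho$, put $J_{ij}=K_{ij}/\sqrt N$ and, given the couplings, let $\sigma,\tau\in\{-1,1\}^N$ be two independent samples (replicas) from the Gibbs distribution of the Sherrington–Kirkpatrick model, which gives $\sigma$ probability proportional to $\exp\big(\beta\sum_{i<j}J_{ij}\sigma_i\sigma_j\big)$. Let $U^1_{ij},U^2_{ij}$ $(1\le i<j\le N)$ be independent mean-one exponential variables, independent of $(K,\sigma,\tau)$. A bond $\{i,j\}$, $i<j$, is satisfied in $\sigma$ unless $J_{ij}\sigma_i\sigma_j<0$, and it is FK-occupied in the first replica if it is satisfied in $\sigma$ and $U^1_{ij}\le 2\beta|J_{ij}|$; the same definitions with $\tau$ and $U^2_{ij}$ apply to the second replica. In the Chayes–Machta–Redner (CMR) representation the bond is blue if it is satisfied in both replicas and FK-occupied in at least one of them. Let $D_k=D_k(N,\beta)$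 be $1/N$ times the number of sites of the $k$-th largest connected component of the graph on $\{1,\dots,N\}$ formed by the blue bonds (isolated sites count as components; $D_k=0$ if there are fewer than $k$ components), and let $Q=Q(N,\beta)=\frac1N\sum_{i=1}^N\sigma_i\tau_i$ be the overlap. Then, as $N\to\infty$, $$D_1-\frac{1+|Q|}{2}\to 0,\qquad D_2-\frac{1-|Q|}{2}\to 0,\qquad D_3\to 0$$ in probability, i.e. for each of these three sequences and every $\varepsilon>0$, the probability that the absolute value exceeds $\varepsilon$ tends to $0$. -/

import Mathlib

open MeasureTheory ProbabilityTheory Filter Topology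

namespace SK

/-- The bonds `{i, j}` of the complete graph on `N` sites, written as ordered pairs `i < j`. -/
abbrev Bond (N : ℕ) : Type := {e : Fin N × Fin N // e.1 < e.2}

/-- Ising spin configurations: every site carries a spin `1` or `-1`. -/
abbrev Spins (N : ℕ) : Type := Fin N → ℤˣ

/-- The spin at a site, as a real number. -/
def spin {N : ℕ} (σ : Spins N) (i : Fin N) : ℝ := ((σ i : ℤ) : ℝ)

/-- The coupling `J_{ij} = K_{ij} / √N`. -/
noncomputable def coupling {N : ℕ} (K : Bond N → ℝ) (e : Bond N) : ℝ := K e / √(N : ℝ)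

/-- `J_{ij} σ_i σ_j`. -/
noncomputable def bondTerm {N : ℕ} (K : Bond N → ℝ) (σ : Spins N) (e : Bond N) : ℝ :=
  coupling K e * spin σ e.1.1 * spin σ e.1.2

/-- The Boltzmann weight `exp (β ∑_{i < j} J_{ij} σ_i σ_j)`. -/
noncomputable def weight {N : ℕ} (β : ℝ) (K : Bond N → ℝ) (σ : Spins N) : ℝ :=
  Real.exp (β * ∑ e : Bond N, bondTerm K σ e)

/-- The Gibbs probability of the configuration `σ`, given the disorder `K`. -/
noncomputable def gibbs {N : ℕ} (β : ℝ) (K : Bond N → ℝ) (σ : Spins N) : ℝ :=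
  weight β K σ / ∑ σ' : Spins N, weight β K σ'

/-- The joint law of the disorder `K`, the first replica `σ` and the second replica `τ`: the
variables `K_{ij}` are i.i.d. with law `ρ` and, given `K`, the configurations `σ` and `τ` are
independent samples of the Gibbs distribution. The density is taken with respect to the product
of the law of `K` and two counting measures. -/
noncomputable def replicaLaw (ρ : Measure ℝ) (β : ℝ) (N : ℕ) :
    Measure ((Bond N → ℝ) × Spins N × Spins N) :=
  ((Measure.pi fun _ : Bond N => ρ).prod
      ((Measure.count : Measure (Spins N)).prod (Measure.count : Measure (Spins N)))).withDensity
    fun x => ENNReal.ofReal (gibbs β x.1 x.2.1 * gibbs β x.1 x.2.2)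

/-- The sample space of the system of size `N`; its points are `((K, σ, τ), (U₁, U₂))`. -/
abbrev Sample (N : ℕ) : Type :=
  ((Bond N → ℝ) × Spins N × Spins N) × (Bond N → ℝ) × (Bond N → ℝ)

/-- The probability measure of the system of size `N`: the families `U₁`, `U₂` consist of
independent exponential variables of mean one, and they are independent of each other and of
`(K, σ, τ)`. -/
noncomputable def law (ρ : Measure ℝ) (β : ℝ) (N : ℕ) : Measure (Sample N) :=
  (replicaLaw ρ β N).prod
    ((Measure.pi fun _ : Bond N => expMeasure 1).prod (Measure.pi fun _ : Bond N => expMeasure 1))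

/-- The bond `e` is satisfied in the replica `σ`, that is, not `J_{ij} σ_i σ_j < 0`. -/
def Satisfied {N : ℕ} (K : Bond N → ℝ) (σ : Spins N) (e : Bond N) : Prop :=
  ¬ bondTerm K σ e < 0

/-- The bond `e` is FK-occupied in the replica `σ` with auxiliary variables `U`: it is satisfied
and `U_{ij} ≤ 2 β |J_{ij}|`. -/
def FKOccupied {N : ℕ} (β : ℝ) (K : Bond N → ℝ) (σ : Spins N) (U : Bond N → ℝ) (e : Bond N) :
    Prop :=
  Satisfied K σ e ∧ U e ≤ 2 * β * |coupling K e|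

/-- The bond `e` is CMR blue: it is satisfied in both replicas and FK-occupied in at least one. -/
def Blue {N : ℕ} (β : ℝ) (ω : Sample N) (e : Bond N) : Prop :=
  Satisfied ω.1.1 ω.1.2.1 e ∧ Satisfied ω.1.1 ω.1.2.2 e ∧
    (FKOccupied β ω.1.1 ω.1.2.1 ω.2.1 e ∨ FKOccupied β ω.1.1 ω.1.2.2 ω.2.2 e)

/-- The graph on the sites whose edges are the blue bonds. -/
def blueGraph {N : ℕ} (β : ℝ) (ω : Sample N) : SimpleGraph (Fin N) :=
  SimpleGraph.fromRel fun i j => ∃ h : i < j, Blue β ω ⟨(i, j), h⟩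

/-- The size of the `k`-th largest cluster (connected component) of `G`, for `k ≥ 1`: the largest
`s` such that at least `k` clusters have at least `s` sites. Clusters of equal size are counted
separately, and the value is `0` if there are fewer than `k` clusters. -/
noncomputable def clusterSize {V : Type*} (G : SimpleGraph V) (k : ℕ) : ℕ :=
  sSup {s : ℕ | k ≤ {C : G.ConnectedComponent | s ≤ C.supp.ncard}.ncard}

/-- The density of the `k`-th largest CMR blue cluster. -/
noncomputable def D {N : ℕ} (β : ℝ) (k : ℕ) (ω : Sample N) : ℝ :=
  (clusterSize (blueGraph β ω) k : ℝ) / N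

/-- The overlap `Q = N⁻¹ ∑_i σ_i τ_i` of the two replicas. -/
noncomputable def Q {N : ℕ} (ω : Sample N) : ℝ :=
  (N : ℝ)⁻¹ * ∑ i : Fin N, spin ω.1.2.1 i * spin ω.1.2.2 i

/-- The random variables `X N`, each on its own probability space, tend to zero in probability. -/
def TendstoZeroInProbability {Ω : ℕ → Type*} [∀ N, MeasurableSpace (Ω N)]
    (P : ∀ N, Measure (Ω N)) (X : ∀ N, Ω N → ℝ) : Prop :=
  ∀ ε : ℝ, 0 < ε → Tendsto (fun N => P N {ω | ε < |X N ω|}) atTop (𝓝 0)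

end SK

/-!
Almost surely no coupling vanishes, and a bond can then be satisfied in both replicas only if
`σ_i τ_i = σ_j τ_j`. Hence no blue bond joins the set `A` of sites where the replicas coincide,
which has `N (1 + Q) / 2` sites, to its complement. It remains to see that `A` and `Aᶜ` are each,
up to `o(N)` sites, a single blue cluster; for this it is enough that, with high probability, no
two disjoint sets `S`, `T` of at least `m` sites, with `m` of order `N`, have the replicas agreeing
on all bonds between them without any of these bonds being blue (`clusterSize_of_unsplittable`,
`abs_D_sub_le`).

The probability of such a cut is bounded by an annealed computation. Jensen's inequality gives
`Z ≥ 2 ^ N` for every disorder (`two_pow_le_sum_weight`), so the density of the Gibbs measure of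
two replicas is at most `4⁻ᴺ` times the product of the two Boltzmann weights, and the factor `4⁻ᴺ`
cancels the number of pairs `(σ, τ)`. The expectation over the couplings then factorizes over the
bonds. An unconstrained bond contributes at most `exp (O(1 / N))`, because `ρ` is even
(`integral_exp_le`), and all these bonds together at most `exp (O(N))`. For a bond between `S` and
`T`, the Boltzmann factor times the conditional probability of not being blue is exactly
`exp (-2 β |J|)` (`exp_mul_notBlueProb`), with expectation at most `exp (-c / √N)` for some `c > 0`
since `ρ` has no atom at `0` (`integral_exp_neg_le`). As there are at least `m ^ 2` such bonds, the
bound `exp (O(N) - c m ^ 2 / √N)` is of the form `exp (-c' N ^ (3 / 2))` and beats the union over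
the `4 ^ N` pairs `(S, T)` (`law_badCutEvent_le`).
-/

namespace SK

/-! ### Cluster sizes of a graph -/

section Clusters

variable {V : Type*} {G : SimpleGraph V}

/-- A set of vertices that no edge leaves, that is, a union of clusters. -/
def NoEdgeLeaves (G : SimpleGraph V) (S : Set V) : Prop :=
  ∀ v ∈ S, ∀ w, G.Adj v w → w ∈ S

/-- `X` cannot be cut along clusters into two parts of at least `m` vertices each. -/
def Unsplittable (G : SimpleGraph V) (m : ℕ) (X : Set V) : Prop :=
  ∀ S ⊆ X, NoEdgeLeaves G S → S.ncard < m ∨ (X \ S).ncard < m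

theorem noEdgeLeaves_supp (C : G.ConnectedComponent) : NoEdgeLeaves G C.supp := by
  intro v hv w hvw
  exact (C.mem_supp_congr_adj hvw).1 hv

theorem NoEdgeLeaves.sdiff {S T : Set V} (hS : NoEdgeLeaves G S) (hT : NoEdgeLeaves G T) :
    NoEdgeLeaves G (S \ T) :=
  fun v hv w hvw => ⟨hS v hv.1 w hvw, fun hw => hv.2 (hT w hw v hvw.symm)⟩

theorem NoEdgeLeaves.compl {S : Set V} (hS : NoEdgeLeaves G S) : NoEdgeLeaves G Sᶜ :=
  fun v hv w hvw hw => hv (hS w hw v hvw.symm)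

theorem NoEdgeLeaves.supp_subset {S : Set V} (hS : NoEdgeLeaves G S) {v : V} (hv : v ∈ S) :
    (G.connectedComponentMk v).supp ⊆ S := by
  intro w hw
  have hr : G.Reachable v w := (SimpleGraph.ConnectedComponent.exact hw).symm
  obtain ⟨p⟩ := hr
  clear hw
  induction p with
  | nil => exact hv
  | cons h _ ih => exact ih (hS _ hv _ h)

theorem NoEdgeLeaves.supp_subset_or {S : Set V} (hS : NoEdgeLeaves G S)
    (C : G.ConnectedComponent) : C.supp ⊆ S ∨ C.supp ⊆ Sᶜ := by
  induction C using SimpleGraph.ConnectedComponent.ind with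
  | h v =>
    by_cases hv : v ∈ S
    · exact Or.inl (hS.supp_subset hv)
    · exact Or.inr (hS.compl.supp_subset hv)

variable [Fintype V]

theorem bddAbove_clusterSize_set {k : ℕ} (hk : 1 ≤ k) :
    BddAbove {s : ℕ | k ≤ {C : G.ConnectedComponent | s ≤ C.supp.ncard}.ncard} := by
  refine ⟨Fintype.card V, fun s hs => ?_⟩
  have hne : {C : G.ConnectedComponent | s ≤ C.supp.ncard}.Nonempty :=
    Set.nonempty_of_ncard_ne_zero (by have := hs; simp only [Set.mem_ofPred_eq] at this; omega)
  obtain ⟨C, hC⟩ := hne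
  calc s ≤ C.supp.ncard := hC
    _ ≤ (Set.univ : Set V).ncard := Set.ncard_le_ncard (Set.subset_univ _)
    _ = Fintype.card V := by rw [Set.ncard_univ, Nat.card_eq_fintype_card]

theorem le_clusterSize {k s : ℕ} (hk : 1 ≤ k)
    (h : k ≤ {C : G.ConnectedComponent | s ≤ C.supp.ncard}.ncard) : s ≤ clusterSize G k :=
  le_csSup (bddAbove_clusterSize_set hk) h

theorem clusterSize_le {k s : ℕ}
    (h : {C : G.ConnectedComponent | s < C.supp.ncard}.ncard < k) : clusterSize G k ≤ s := by
  refine csSup_le' fun t ht => ?_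
  by_contra! hst
  have hsub : {C : G.ConnectedComponent | t ≤ C.supp.ncard} ⊆
      {C : G.ConnectedComponent | s < C.supp.ncard} := fun C hC => lt_of_lt_of_le hst hC
  have := Set.ncard_le_ncard hsub (Set.toFinite _)
  have ht' : k ≤ _ := ht
  omega

/-- An unsplittable union of clusters is, up to few vertices, a single cluster. -/
theorem Unsplittable.exists_giant {m : ℕ} {X : Set V} (hX : NoEdgeLeaves G X)
    (hU : Unsplittable G m X) (hne : X.Nonempty) :
    ∃ C₀ : G.ConnectedComponent, C₀.supp ⊆ X ∧ X.ncard ≤ C₀.supp.ncard + 3 * m ∧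
      ∀ C : G.ConnectedComponent, C.supp ⊆ X → C ≠ C₀ → C.supp.ncard ≤ 3 * m := by
  classical
  by_cases hsmall : X.ncard ≤ 3 * m
  · obtain ⟨v, hv⟩ := hne
    exact ⟨G.connectedComponentMk v, hX.supp_subset hv, by omega,
      fun C hC _ => (Set.ncard_le_ncard hC (Set.toFinite _)).trans hsmall⟩
  -- Among the unions of clusters in `X` with at least `m` vertices, take a smallest one: removing
  -- a cluster from it leaves fewer than `m` vertices, so that cluster must be large.
  obtain ⟨S, ⟨hSX, hS, hSm⟩, hmin⟩ := Set.exists_min_image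
    {S : Set V | S ⊆ X ∧ NoEdgeLeaves G S ∧ m ≤ S.ncard} Set.ncard (Set.toFinite _)
    ⟨X, subset_rfl, hX, by omega⟩
  have hcompl : (X \ S).ncard < m := (hU S hSX hS).resolve_left (by omega)
  have hcard := Set.ncard_sdiff_add_ncard_of_subset hSX (Set.toFinite _)
  obtain ⟨v, hv⟩ : S.Nonempty := Set.nonempty_of_ncard_ne_zero (by omega)
  have hCS := hS.supp_subset hv
  have hcardS := Set.ncard_sdiff_add_ncard_of_subset hCS (Set.toFinite _)
  have hpos : 0 < (G.connectedComponentMk v).supp.ncard :=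
    (Set.ncard_pos (Set.toFinite _)).2 ⟨v, rfl⟩
  have hrest : (S \ (G.connectedComponentMk v).supp).ncard < m := by
    by_contra! hge
    have := hmin _ ⟨Set.sdiff_subset.trans hSX, hS.sdiff (noEdgeLeaves_supp _), hge⟩
    omega
  have hCX := hCS.trans hSX
  have hout := (hU _ hCX (noEdgeLeaves_supp _)).resolve_left (by omega)
  have hcardX := Set.ncard_sdiff_add_ncard_of_subset hCX (Set.toFinite _)
  refine ⟨G.connectedComponentMk v, hCX, by omega, fun C hC hne => ?_⟩
  have hsub : C.supp ⊆ X \ (G.connectedComponentMk v).supp := fun w hw =>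
    ⟨hC hw, fun hw' => hne (hw.symm.trans hw')⟩
  have := Set.ncard_le_ncard hsub (Set.toFinite _)
  omega

/-- If the vertices fall into two unsplittable unions of clusters `A` and `Aᶜ`, then these are, up
to few vertices, the two largest clusters, and all the other clusters are small. -/
theorem clusterSize_of_unsplittable {m : ℕ} {A : Set V} (hA : NoEdgeLeaves G A)
    (hU : Unsplittable G m A) (hU' : Unsplittable G m Aᶜ) (hle : Aᶜ.ncard ≤ A.ncard)
    (hne : A.Nonempty) :
    (A.ncard ≤ clusterSize G 1 + 3 * m ∧ clusterSize G 1 ≤ A.ncard) ∧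
      (Aᶜ.ncard ≤ clusterSize G 2 + 3 * m ∧ clusterSize G 2 ≤ Aᶜ.ncard + 3 * m) ∧
      clusterSize G 3 ≤ 3 * m := by
  classical
  obtain ⟨C₁, hC₁, hC₁card, hC₁out⟩ := hU.exists_giant hA hne
  have hsize : ∀ C : G.ConnectedComponent, ∀ S : Set V, C.supp ⊆ S → C.supp.ncard ≤ S.ncard :=
    fun C S hC => Set.ncard_le_ncard hC (Set.toFinite _)
  have hlow₁ : A.ncard - 3 * m ≤ clusterSize G 1 := by
    refine le_clusterSize le_rfl ?_
    have : (0 : ℕ) < _ := (Set.ncard_pos (Set.toFinite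
      {C : G.ConnectedComponent | A.ncard - 3 * m ≤ C.supp.ncard})).2 ⟨C₁, by
        simp only [Set.mem_ofPred_eq]; omega⟩
    omega
  have hup₁ : clusterSize G 1 ≤ A.ncard := by
    refine clusterSize_le ?_
    rw [Nat.lt_one_iff, Set.ncard_eq_zero (Set.toFinite _)]
    ext C
    simp only [Set.mem_ofPred_eq, Set.mem_empty_iff_false, iff_false, not_lt]
    rcases hA.supp_subset_or C with h | h
    · exact hsize C _ h
    · exact (hsize C _ h).trans hle
  have hup₂ : clusterSize G 2 ≤ Aᶜ.ncard + 3 * m := by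
    refine clusterSize_le (lt_of_le_of_lt (Set.ncard_le_ncard (t := {C₁}) ?_) (by simp))
    intro C hC
    by_contra hCne
    have hC : Aᶜ.ncard + 3 * m < C.supp.ncard := hC
    rcases hA.supp_subset_or C with h | h
    · have := hC₁out C h hCne
      omega
    · have := hsize C _ h
      omega
  by_cases hne' : Aᶜ.Nonempty
  · obtain ⟨C₂, hC₂, hC₂card, hC₂out⟩ := hU'.exists_giant hA.compl hne'
    have hne₁₂ : C₁ ≠ C₂ := by
      rintro rfl
      obtain ⟨v, hv⟩ := C₁.nonempty_supp
      exact hC₂ hv (hC₁ hv)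
    refine ⟨⟨by omega, hup₁⟩, ⟨?_, hup₂⟩, ?_⟩
    · have : Aᶜ.ncard - 3 * m ≤ clusterSize G 2 := by
        refine le_clusterSize (by norm_num) ?_
        rw [← Set.ncard_pair hne₁₂]
        refine Set.ncard_le_ncard ?_ (Set.toFinite _)
        rintro C (rfl | rfl) <;> simp only [Set.mem_ofPred_eq] <;> omega
      omega
    · refine clusterSize_le (lt_of_le_of_lt (Set.ncard_le_ncard (t := {C₁, C₂}) ?_)
        (by rw [Set.ncard_pair hne₁₂]; norm_num))
      intro C hC
      by_contra hCne
      simp only [Set.mem_insert_iff, Set.mem_singleton_iff, not_or] at hCne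
      have hC : 3 * m < C.supp.ncard := hC
      rcases hA.supp_subset_or C with h | h
      · have := hC₁out C h hCne.1
        omega
      · have := hC₂out C h hCne.2
        omega
  · rw [Set.not_nonempty_iff_eq_empty] at hne'
    have h0 : Aᶜ.ncard = 0 := by rw [hne']; simp
    refine ⟨⟨by omega, hup₁⟩, ⟨by omega, hup₂⟩, ?_⟩
    refine clusterSize_le (lt_of_le_of_lt (Set.ncard_le_ncard (t := {C₁}) ?_) (by simp))
    intro C hC
    by_contra hCne
    have hC : 3 * m < C.supp.ncard := hC
    rcases hA.supp_subset_or C with h | h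
    · have := hC₁out C h hCne
      omega
    · have := hsize C _ h
      omega

end Clusters

/-! ### Integrals over one coupling -/

section OneBond

theorem exp_le_one_add_add_sq_mul_exp_abs (x : ℝ) :
    Real.exp x ≤ 1 + x + x ^ 2 * Real.exp |x| := by
  have h := Complex.norm_exp_sub_sum_le_norm_mul_exp (x : ℂ) 2
  have hx : Complex.exp x - ∑ m ∈ Finset.range 2, (x : ℂ) ^ m / m.factorial =
      ((Real.exp x - (1 + x) : ℝ) : ℂ) := by
    simp [Finset.sum_range_succ]
  rw [hx, Complex.norm_real, Complex.norm_real, Real.norm_eq_abs, Real.norm_eq_abs, sq_abs] at h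
  linarith [le_abs_self (Real.exp x - (1 + x))]

variable {ρ : Measure ℝ}

theorem integral_id_eq_zero_of_even (hρ_even : ρ.map (fun x => -x) = ρ) : ∫ x, x ∂ρ = 0 := by
  have h : ∫ x, x ∂ρ = ∫ x, -x ∂ρ := by
    conv_lhs => rw [← hρ_even]
    exact integral_map measurable_neg.aemeasurable aestronglyMeasurable_id
  rw [integral_neg] at h
  linarith

theorem integrable_abs_pow_mul_exp_mul_abs
    (hρ_mgf : ∀ t : ℝ, Integrable (fun x => Real.exp (t * x)) ρ) (n : ℕ) (a : ℝ) :
    Integrable (fun x => |x| ^ n * Real.exp (a * |x|)) ρ := by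
  have h (b : ℝ) : Integrable (fun x => |x| ^ n * Real.exp (b * x)) ρ :=
    integrable_pow_abs_mul_exp_of_integrable_exp_mul (X := fun x : ℝ => x) one_ne_zero
      (hρ_mgf _) (hρ_mgf _) n
  refine ((h a).add (h (-a))).mono' (by fun_prop) (Eventually.of_forall fun x => ?_)
  rw [Real.norm_of_nonneg (by positivity), Pi.add_apply, ← mul_add]
  gcongr
  rcases abs_choice x with hx | hx <;> rw [hx]
  · linarith [Real.exp_pos (-a * x)]
  · rw [mul_neg, ← neg_mul]
    linarith [Real.exp_pos (a * x)]

theorem integrable_id_of_mgf (hρ_mgf : ∀ t : ℝ, Integrable (fun x => Real.exp (t * x)) ρ) :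
    Integrable (fun x => x) ρ := by
  have h := integrable_abs_pow_mul_exp_mul_abs hρ_mgf 1 0
  simp only [pow_one, zero_mul, Real.exp_zero, mul_one] at h
  exact (integrable_norm_iff aestronglyMeasurable_id).1 h

variable [IsProbabilityMeasure ρ]

/-- A bond without constraint contributes at most a factor `exp (O(1 / N))`: the term of first order
vanishes because `ρ` is even. -/
theorem integral_exp_le (hρ_even : ρ.map (fun x => -x) = ρ)
    (hρ_mgf : ∀ t : ℝ, Integrable (fun x => Real.exp (t * x)) ρ) {a t : ℝ} {N : ℕ} (hN : 1 ≤ N)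
    (ht : |t| ≤ a / √N) :
    ∫ x, Real.exp (t * x) ∂ρ ≤ Real.exp (a ^ 2 * (∫ x, |x| ^ 2 * Real.exp (a * |x|) ∂ρ) / N) := by
  have hN0 : (0 : ℝ) < N := by exact_mod_cast hN
  have hsqrt : 1 ≤ √(N : ℝ) := Real.one_le_sqrt.2 (by exact_mod_cast hN)
  have ha : 0 ≤ a := by
    have := (abs_nonneg t).trans ht
    rwa [le_div_iff₀ (by linarith), zero_mul] at this
  have hta : |t| ≤ a := ht.trans (div_le_self ha hsqrt)
  have ht2 : t ^ 2 ≤ a ^ 2 / N := by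
    rw [← sq_abs]
    calc |t| ^ 2 ≤ (a / √N) ^ 2 := by gcongr
      _ = a ^ 2 / N := by rw [div_pow, Real.sq_sqrt hN0.le]
  have hint := integrable_abs_pow_mul_exp_mul_abs hρ_mgf 2 a
  have hid := (integrable_id_of_mgf hρ_mgf).const_mul t
  have hlin : Integrable (fun x => 1 + t * x) ρ := (integrable_const _).add hid
  calc ∫ x, Real.exp (t * x) ∂ρ
      ≤ ∫ x, (1 + t * x + a ^ 2 / N * (|x| ^ 2 * Real.exp (a * |x|))) ∂ρ := by
        refine integral_mono (hρ_mgf t) (hlin.add (hint.const_mul _)) fun x => ?_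
        have h := exp_le_one_add_add_sq_mul_exp_abs (t * x)
        have h2 : (t * x) ^ 2 * Real.exp |t * x| ≤ a ^ 2 / N * (|x| ^ 2 * Real.exp (a * |x|)) := by
          rw [mul_pow, abs_mul, sq_abs, ← mul_assoc]
          gcongr
        dsimp only
        linarith
    _ = 1 + a ^ 2 / N * ∫ x, |x| ^ 2 * Real.exp (a * |x|) ∂ρ := by
        rw [integral_add hlin (hint.const_mul _),
          integral_add (integrable_const _) hid, integral_const_mul,
          integral_const_mul, integral_id_eq_zero_of_even hρ_even]
        simp
    _ ≤ Real.exp (a ^ 2 / N * ∫ x, |x| ^ 2 * Real.exp (a * |x|) ∂ρ) := by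
        rw [add_comm]
        exact Real.add_one_le_exp _
    _ = _ := by ring_nf

theorem integrable_exp_neg_mul_abs {a : ℝ} (ha : 0 ≤ a) :
    Integrable (fun x : ℝ => Real.exp (-(a * |x|))) ρ := by
  refine (integrable_const (1 : ℝ)).mono' (by fun_prop) (Eventually.of_forall fun x => ?_)
  rw [Real.norm_of_nonneg (Real.exp_pos _).le]
  exact Real.exp_le_one_iff.2 (by have := mul_nonneg ha (abs_nonneg x); linarith)

theorem integral_abs_mul_exp_neg_pos (hρ_zero : ρ {0} = 0)
    (hρ_mgf : ∀ t : ℝ, Integrable (fun x => Real.exp (t * x)) ρ) {a : ℝ} (ha : 0 < a) :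
    0 < ∫ x, a * (|x| ^ 1 * Real.exp (-a * |x|)) ∂ρ := by
  rw [integral_pos_iff_support_of_nonneg (fun x => by positivity)
    ((integrable_abs_pow_mul_exp_mul_abs hρ_mgf 1 _).const_mul a)]
  have hs : Function.support (fun x : ℝ => a * (|x| ^ 1 * Real.exp (-a * |x|))) = {0}ᶜ := by
    ext x
    simp [ha.ne']
  rw [hs, prob_compl_eq_one_sub (measurableSet_singleton _), hρ_zero]
  simp

/-- A bond that is not blue although both replicas agree on it costs a factor
`exp (-c / √N)`. -/
theorem integral_exp_neg_le (hρ_mgf : ∀ t : ℝ, Integrable (fun x => Real.exp (t * x)) ρ)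
    {a : ℝ} (ha : 0 < a) {N : ℕ} (hN : 1 ≤ N) :
    ∫ x, Real.exp (-(a / √N * |x|)) ∂ρ ≤
      Real.exp (-((∫ x, a * (|x| ^ 1 * Real.exp (-a * |x|)) ∂ρ) / √N)) := by
  have hsqrt : 1 ≤ √(N : ℝ) := Real.one_le_sqrt.2 (by exact_mod_cast hN)
  have hint := (integrable_abs_pow_mul_exp_mul_abs hρ_mgf 1 (-a)).const_mul a
  calc ∫ x, Real.exp (-(a / √N * |x|)) ∂ρ
      ≤ ∫ x, (1 - 1 / √N * (a * (|x| ^ 1 * Real.exp (-a * |x|)))) ∂ρ := by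
        refine integral_mono (integrable_exp_neg_mul_abs (by positivity))
          ((integrable_const _).sub (hint.const_mul _)) fun x => ?_
        -- `1 - exp (-y) ≥ y exp (-y)`
        have h := Real.add_one_le_exp (a / √N * |x|)
        have h1 : (a / √N * |x| + 1) * Real.exp (-(a / √N * |x|)) ≤ 1 := by
          calc _ ≤ Real.exp (a / √N * |x|) * Real.exp (-(a / √N * |x|)) := by gcongr
            _ = 1 := by rw [← Real.exp_add, add_neg_cancel, Real.exp_zero]
        have h2 : Real.exp (-a * |x|) ≤ Real.exp (-(a / √N * |x|)) := by
          rw [neg_mul]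
          gcongr
          exact div_le_self ha.le hsqrt
        have h3 : a / √N * |x| * Real.exp (-a * |x|) ≤
            a / √N * |x| * Real.exp (-(a / √N * |x|)) := by gcongr
        have h4 : 1 / √N * (a * (|x| ^ 1 * Real.exp (-a * |x|))) =
            a / √N * |x| * Real.exp (-a * |x|) := by ring
        dsimp only
        linarith
    _ = 1 - (∫ x, a * (|x| ^ 1 * Real.exp (-a * |x|)) ∂ρ) / √N := by
        rw [integral_sub (integrable_const _) (hint.const_mul _), integral_const_mul (1 / √(N : ℝ))]
        simp only [integral_const, probReal_univ, one_smul]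
        ring
    _ ≤ _ := Real.one_sub_le_exp_neg _

end OneBond

/-! ### The Gibbs weights -/

section Gibbs

variable {N : ℕ}

theorem spin_mul_self (σ : Spins N) (i : Fin N) : spin σ i * spin σ i = 1 := by
  unfold spin
  rcases Int.units_eq_one_or (σ i) with h | h <;> simp [h]

theorem spin_eq_or (σ : Spins N) (i : Fin N) : spin σ i = 1 ∨ spin σ i = -1 := by
  unfold spin
  rcases Int.units_eq_one_or (σ i) with h | h <;> simp [h]

theorem bond_spin_eq_or (σ : Spins N) (e : Bond N) :
    spin σ e.1.1 * spin σ e.1.2 = 1 ∨ spin σ e.1.1 * spin σ e.1.2 = -1 := by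
  rcases spin_eq_or σ e.1.1 with h | h <;> rcases spin_eq_or σ e.1.2 with h' | h' <;> simp [h, h']

theorem sum_spin_mul_spin (e : Bond N) : ∑ σ : Spins N, spin σ e.1.1 * spin σ e.1.2 = 0 := by
  classical
  -- Flipping the spin at one end of the bond changes the sign of the sum.
  let flip : Spins N ≃ Spins N := Equiv.piCongrRight fun i =>
    if i = e.1.1 then Equiv.neg ℤˣ else Equiv.refl ℤˣ
  have h := Equiv.sum_comp flip fun σ : Spins N => spin σ e.1.1 * spin σ e.1.2
  have h' : ∀ σ : Spins N, spin (flip σ) e.1.1 * spin (flip σ) e.1.2 =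
      -(spin σ e.1.1 * spin σ e.1.2) := by
    intro σ
    have hne : e.1.2 ≠ e.1.1 := (ne_of_lt e.2).symm
    simp [flip, spin, hne]
  simp only [h', Finset.sum_neg_distrib] at h
  linarith

/-- Jensen's inequality bounds the partition function from below by its value at `β = 0`,
uniformly in the disorder. -/
theorem two_pow_le_sum_weight (β : ℝ) (K : Bond N → ℝ) :
    (2 : ℝ) ^ N ≤ ∑ σ : Spins N, weight β K σ := by
  calc (2 : ℝ) ^ N = ∑ σ : Spins N, (β * ∑ e : Bond N, bondTerm K σ e + 1) := by
        rw [Finset.sum_add_distrib, ← Finset.mul_sum, Finset.sum_comm]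
        have h : ∀ e : Bond N, ∑ σ : Spins N, bondTerm K σ e = 0 := by
          intro e
          simp only [bondTerm, mul_assoc, ← Finset.mul_sum, sum_spin_mul_spin, mul_zero]
        simp [h]
    _ ≤ _ := Finset.sum_le_sum fun σ _ => Real.add_one_le_exp _

theorem gibbs_nonneg (β : ℝ) (K : Bond N → ℝ) (σ : Spins N) : 0 ≤ gibbs β K σ :=
  div_nonneg (Real.exp_pos _).le (Finset.sum_nonneg fun _ _ => (Real.exp_pos _).le)

theorem gibbs_le (β : ℝ) (K : Bond N → ℝ) (σ : Spins N) :
    gibbs β K σ ≤ (2 ^ N)⁻¹ * weight β K σ := by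
  rw [gibbs, div_eq_inv_mul]
  have := two_pow_le_sum_weight β K
  have hw : 0 ≤ weight β K σ := (Real.exp_pos _).le
  gcongr

theorem measurable_gibbs (β : ℝ) (σ : Spins N) : Measurable fun K : Bond N → ℝ => gibbs β K σ := by
  unfold gibbs weight bondTerm coupling
  fun_prop

/-- Both replicas give the bond `e` the same product of spins, so that `e` is satisfied in both or
in none of them. -/
def Agree (σ τ : Spins N) (e : Bond N) : Prop :=
  spin σ e.1.1 * spin σ e.1.2 = spin τ e.1.1 * spin τ e.1.2

theorem Agree.bondTerm_eq {σ τ : Spins N} {e : Bond N} (h : Agree σ τ e) (K : Bond N → ℝ) :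
    bondTerm K σ e = bondTerm K τ e := by
  simp only [bondTerm, mul_assoc]
  rw [h]

theorem weight_mul_weight (β : ℝ) (K : Bond N → ℝ) (σ τ : Spins N) :
    weight β K σ * weight β K τ =
      ∏ e : Bond N, Real.exp (β * (bondTerm K σ e + bondTerm K τ e)) := by
  rw [weight, weight, ← Real.exp_add, ← Real.exp_sum, ← mul_add, ← Finset.sum_add_distrib,
    Finset.mul_sum]

open Classical in
/-- The conditional probability, given the disorder and the replicas, that the bond `e` on which
the replicas agree is not blue. -/
noncomputable def notBlueProb (β : ℝ) (K : Bond N → ℝ) (σ : Spins N) (e : Bond N) : ℝ :=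
  if Satisfied K σ e then Real.exp (-(4 * β * |coupling K e|)) else 1

/-- Whatever the sign of the coupling, the Boltzmann factor of a bond on which the replicas agree,
times the probability that this bond is not blue, equals `exp (-2 β |J|)`. -/
theorem exp_mul_notBlueProb {β : ℝ} {K : Bond N → ℝ} {σ τ : Spins N} {e : Bond N}
    (h : Agree σ τ e) :
    Real.exp (β * (bondTerm K σ e + bondTerm K τ e)) * notBlueProb β K σ e =
      Real.exp (-(2 * β / √N * |K e|)) := by
  rw [← h.bondTerm_eq K]
  have habs : |bondTerm K σ e| = |coupling K e| := by
    rw [bondTerm, mul_assoc, abs_mul]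
    rcases bond_spin_eq_or σ e with hs | hs <;> simp [hs]
  have hK : |coupling K e| = |K e| / √N := by
    rw [coupling, abs_div, abs_of_nonneg (Real.sqrt_nonneg _)]
  have hrhs : -(2 * β / √N * |K e|) = -(2 * β * |coupling K e|) := by
    rw [hK]
    ring
  rw [hrhs, notBlueProb]
  split_ifs with hsat
  · rw [Satisfied, not_lt] at hsat
    rw [← Real.exp_add, ← habs, abs_of_nonneg hsat]
    ring_nf
  · rw [Satisfied, not_not] at hsat
    rw [mul_one, ← habs, abs_of_neg hsat]
    ring_nf

end Gibbs

/-! ### The probability that given bonds are not blue -/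

section NotBlue

instance : MeasurableSingletonClass ℤˣ where
  measurableSet_singleton u :=
    ⟨{(u : ℤ)}, measurableSet_singleton _, by ext v; simp [Units.ext_iff]⟩

instance : IsProbabilityMeasure (expMeasure 1) := isProbabilityMeasure_expMeasure one_pos

theorem expMeasure_one_Ioi {x : ℝ} (hx : 0 ≤ x) :
    expMeasure 1 (Set.Ioi x) = ENNReal.ofReal (Real.exp (-x)) := by
  have h : ENNReal.ofReal (1 - Real.exp (-x)) = expMeasure 1 (Set.Iic x) := by
    rw [← ofReal_cdf, cdf_expMeasure_eq one_pos, if_pos hx, one_mul]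
  rw [← Set.compl_Iic, prob_compl_eq_one_sub measurableSet_Iic, ← h,
    ← ENNReal.ofReal_one, ← ENNReal.ofReal_sub _ (by simpa using hx), sub_sub_cancel]

variable {N : ℕ}

theorem notBlueProb_nonneg (β : ℝ) (K : Bond N → ℝ) (σ : Spins N) (e : Bond N) :
    0 ≤ notBlueProb β K σ e := by
  unfold notBlueProb
  split_ifs
  · positivity
  · exact zero_le_one

theorem measure_forall_not_blue_le {β : ℝ} (hβ : 0 < β) (K : Bond N → ℝ) {σ τ : Spins N}
    {E : Finset (Bond N)} (hE : ∀ e ∈ E, Agree σ τ e) :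
    ((Measure.pi fun _ : Bond N => expMeasure 1).prod (Measure.pi fun _ : Bond N => expMeasure 1))
        {U | ∀ e ∈ E, ¬ Blue β ((K, σ, τ), U) e} ≤
      ENNReal.ofReal (∏ e ∈ E, notBlueProb β K σ e) := by
  classical
  let t : Bond N → Set ℝ := fun e =>
    if e ∈ E ∧ Satisfied K σ e then Set.Ioi (2 * β * |coupling K e|) else Set.univ
  have hsub : {U : (Bond N → ℝ) × (Bond N → ℝ) | ∀ e ∈ E, ¬ Blue β ((K, σ, τ), U) e} ⊆
      (Set.univ.pi t) ×ˢ (Set.univ.pi t) := by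
    rintro ⟨U₁, U₂⟩ hU
    have key : ∀ e ∈ E, Satisfied K σ e →
        2 * β * |coupling K e| < U₁ e ∧ 2 * β * |coupling K e| < U₂ e := by
      intro e he hs
      have hs' : Satisfied K τ e := by rwa [Satisfied, ← (hE e he).bondTerm_eq K]
      have h : ¬ Blue β ((K, σ, τ), (U₁, U₂)) e := hU e he
      simp only [Blue, FKOccupied, hs, hs', true_and, not_or, not_le] at h
      exact h
    constructor <;> intro e _ <;> by_cases h : e ∈ E ∧ Satisfied K σ e
    · simpa [t, h] using (key e h.1 h.2).1
    · simp [t, h]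
    · simpa [t, h] using (key e h.1 h.2).2
    · simp [t, h]
  refine (measure_mono hsub).trans_eq ?_
  have hfac : ∀ e, expMeasure 1 (t e) * expMeasure 1 (t e) =
      ENNReal.ofReal (if e ∈ E then notBlueProb β K σ e else 1) := by
    intro e
    by_cases he : e ∈ E
    · by_cases hs : Satisfied K σ e
      · have h0 : 0 ≤ 2 * β * |coupling K e| := by positivity
        simp only [t, he, hs, and_self, if_true, notBlueProb]
        rw [expMeasure_one_Ioi h0, ← ENNReal.ofReal_mul (Real.exp_pos _).le, ← Real.exp_add]
        ring_nf
      · simp [t, he, hs, notBlueProb]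
    · simp [t, he]
  rw [Measure.prod_prod, Measure.pi_pi, ← Finset.prod_mul_distrib, Finset.prod_congr rfl
    fun e _ => hfac e, ← ENNReal.ofReal_prod_of_nonneg]
  · simp [Finset.prod_ite_mem]
  · intro e _
    split_ifs
    · exact notBlueProb_nonneg β K σ e
    · exact zero_le_one

theorem measurable_bondTerm_fst (e : Bond N) :
    Measurable fun ω : Sample N => bondTerm ω.1.1 ω.1.2.1 e := by
  have h (i : Fin N) : Measurable fun ω : Sample N => spin ω.1.2.1 i :=
    (measurable_of_countable fun σ : Spins N => spin σ i).comp (by fun_prop)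
  unfold bondTerm coupling
  have := h e.1.1
  have := h e.1.2
  fun_prop

theorem measurable_bondTerm_snd (e : Bond N) :
    Measurable fun ω : Sample N => bondTerm ω.1.1 ω.1.2.2 e := by
  have h (i : Fin N) : Measurable fun ω : Sample N => spin ω.1.2.2 i :=
    (measurable_of_countable fun σ : Spins N => spin σ i).comp (by fun_prop)
  unfold bondTerm coupling
  have := h e.1.1
  have := h e.1.2
  fun_prop

theorem measurableSet_blue (β : ℝ) (e : Bond N) : MeasurableSet {ω : Sample N | Blue β ω e} := by
  have h₁ := measurableSet_lt (measurable_bondTerm_fst e) (measurable_const (a := (0 : ℝ)))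
  have h₂ := measurableSet_lt (measurable_bondTerm_snd e) (measurable_const (a := (0 : ℝ)))
  have hJ : Measurable fun ω : Sample N => 2 * β * |coupling ω.1.1 e| := by
    unfold coupling
    fun_prop
  have h₃ : MeasurableSet {ω : Sample N | ω.2.1 e ≤ 2 * β * |coupling ω.1.1 e|} :=
    measurableSet_le (by fun_prop) hJ
  have h₄ : MeasurableSet {ω : Sample N | ω.2.2 e ≤ 2 * β * |coupling ω.1.1 e|} :=
    measurableSet_le (by fun_prop) hJ
  exact h₁.compl.inter (h₂.compl.inter ((h₁.compl.inter h₃).union (h₂.compl.inter h₄)))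

/-- The event that the two replicas agree on all the bonds in `E`, but none of these bonds is blue. -/
def notBlueEvent (β : ℝ) (E : Finset (Bond N)) : Set (Sample N) :=
  {ω | ∀ e ∈ E, Agree ω.1.2.1 ω.1.2.2 e ∧ ¬ Blue β ω e}

theorem measurableSet_notBlueEvent (β : ℝ) (E : Finset (Bond N)) :
    MeasurableSet (notBlueEvent β E) := by
  have h : notBlueEvent β E = ⋂ e ∈ E, ({ω | Agree ω.1.2.1 ω.1.2.2 e} ∩ {ω | Blue β ω e}ᶜ) := by
    ext ω
    simp [notBlueEvent]
  rw [h]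
  refine Finset.measurableSet_biInter E fun e _ => ?_
  have hA : Measurable fun ω : Sample N => ω.1.2 := by fun_prop
  exact (hA (Set.to_countable {p : Spins N × Spins N | Agree p.1 p.2 e}).measurableSet).inter
    (measurableSet_blue β e).compl

open Classical in
/-- The factor of the bond `e` in the bound on the joint density, after the variables `U` have been
integrated out. -/
noncomputable def bondFactor (β : ℝ) (E : Finset (Bond N)) (σ τ : Spins N) (e : Bond N) (x : ℝ) :
    ℝ :=
  if e ∈ E then Real.exp (-(2 * β / √N * |x|))
  else Real.exp (β * (spin σ e.1.1 * spin σ e.1.2 + spin τ e.1.1 * spin τ e.1.2) / √N * x)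

theorem bondFactor_pos (β : ℝ) (E : Finset (Bond N)) (σ τ : Spins N) (e : Bond N) (x : ℝ) :
    0 < bondFactor β E σ τ e x := by
  unfold bondFactor
  split_ifs <;> positivity

theorem density_mul_measure_section_le {β : ℝ} (hβ : 0 < β) (E : Finset (Bond N))
    (x : (Bond N → ℝ) × Spins N × Spins N) :
    ENNReal.ofReal (gibbs β x.1 x.2.1 * gibbs β x.1 x.2.2) *
        ((Measure.pi fun _ : Bond N => expMeasure 1).prod
          (Measure.pi fun _ : Bond N => expMeasure 1)) (Prod.mk x ⁻¹' notBlueEvent β E) ≤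
      ENNReal.ofReal ((4 ^ N)⁻¹ * ∏ e, bondFactor β E x.2.1 x.2.2 e (x.1 e)) := by
  classical
  obtain ⟨K, σ, τ⟩ := x
  dsimp only
  by_cases hE : ∀ e ∈ E, Agree σ τ e
  · have hsub : Prod.mk (K, σ, τ) ⁻¹' notBlueEvent β E ⊆
        {U | ∀ e ∈ E, ¬ Blue β ((K, σ, τ), U) e} := fun U hU e he => (hU e he).2
    have hp : 0 ≤ ∏ e ∈ E, notBlueProb β K σ e :=
      Finset.prod_nonneg fun e _ => notBlueProb_nonneg β K σ e
    have hσ := gibbs_le β K σ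
    have hτ := gibbs_le β K τ
    have h₁ := gibbs_nonneg β K σ
    have h₂ := gibbs_nonneg β K τ
    have hw : 0 ≤ weight β K σ := (Real.exp_pos _).le
    calc _ ≤ ENNReal.ofReal (gibbs β K σ * gibbs β K τ) *
          ENNReal.ofReal (∏ e ∈ E, notBlueProb β K σ e) := by
          gcongr
          exact (measure_mono hsub).trans (measure_forall_not_blue_le hβ K hE)
      _ = ENNReal.ofReal (gibbs β K σ * gibbs β K τ * ∏ e ∈ E, notBlueProb β K σ e) :=
          (ENNReal.ofReal_mul (mul_nonneg h₁ h₂)).symm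
      _ ≤ ENNReal.ofReal (((2 ^ N)⁻¹ * weight β K σ) * ((2 ^ N)⁻¹ * weight β K τ) *
            ∏ e ∈ E, notBlueProb β K σ e) := by gcongr
      _ = _ := by
          have h4 : ((4 : ℝ) ^ N)⁻¹ = (2 ^ N)⁻¹ * (2 ^ N)⁻¹ := by
            rw [← mul_inv, ← mul_pow]
            norm_num
          have hprod : ∏ e ∈ E, notBlueProb β K σ e =
              ∏ e, if e ∈ E then notBlueProb β K σ e else 1 := by
            simp [Finset.prod_ite_mem]
          have hfac : ∏ e, bondFactor β E σ τ e (K e) =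
              weight β K σ * weight β K τ * ∏ e ∈ E, notBlueProb β K σ e := by
            rw [weight_mul_weight, hprod, ← Finset.prod_mul_distrib]
            refine Finset.prod_congr rfl fun e _ => ?_
            unfold bondFactor
            split_ifs with he
            · exact (exp_mul_notBlueProb (hE e he)).symm
            · rw [mul_one]
              simp only [bondTerm, coupling]
              ring_nf
          rw [hfac, h4]
          ring_nf
  · have hempty : Prod.mk (K, σ, τ) ⁻¹' notBlueEvent β E = ∅ := by
      ext U
      simp only [Set.mem_preimage, Set.mem_empty_iff_false, iff_false]
      exact fun hU => hE fun e he => (hU e he).1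
    simp [hempty]

variable {ρ : Measure ℝ} [IsProbabilityMeasure ρ]

theorem integrable_bondFactor (hρ_mgf : ∀ t : ℝ, Integrable (fun x => Real.exp (t * x)) ρ)
    {β : ℝ} (hβ : 0 < β) (E : Finset (Bond N)) (σ τ : Spins N) (e : Bond N) :
    Integrable (bondFactor β E σ τ e) ρ := by
  unfold bondFactor
  split_ifs
  · exact integrable_exp_neg_mul_abs (by positivity)
  · exact hρ_mgf _

theorem abs_spin_sum_le (σ τ : Spins N) (e : Bond N) :
    |spin σ e.1.1 * spin σ e.1.2 + spin τ e.1.1 * spin τ e.1.2| ≤ 2 := by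
  rcases bond_spin_eq_or σ e with h | h <;> rcases bond_spin_eq_or τ e with h' | h' <;>
    norm_num [h, h']

open Classical in
theorem prod_integral_bondFactor_le (hρ_even : ρ.map (fun x => -x) = ρ)
    (hρ_mgf : ∀ t : ℝ, Integrable (fun x => Real.exp (t * x)) ρ) {β : ℝ} (hβ : 0 < β)
    (hN : 1 ≤ N) (E : Finset (Bond N)) (σ τ : Spins N) :
    ∏ e, ∫ x, bondFactor β E σ τ e x ∂ρ ≤
      Real.exp ((2 * β) ^ 2 * (∫ x, |x| ^ 2 * Real.exp (2 * β * |x|) ∂ρ) * N -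
        (∫ x, 2 * β * (|x| ^ 1 * Real.exp (-(2 * β) * |x|)) ∂ρ) * E.card / √N) := by
  set C := (2 * β) ^ 2 * ∫ x, |x| ^ 2 * Real.exp (2 * β * |x|) ∂ρ
  set c := ∫ x, 2 * β * (|x| ^ 1 * Real.exp (-(2 * β) * |x|)) ∂ρ
  have hN0 : (0 : ℝ) < N := by exact_mod_cast hN
  have hC : 0 ≤ C := mul_nonneg (by positivity) (integral_nonneg fun x => by positivity)
  have hbond : ∀ e, ∫ x, bondFactor β E σ τ e x ∂ρ ≤
      Real.exp (C / N) * if e ∈ E then Real.exp (-(c / √N)) else 1 := by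
    intro e
    unfold bondFactor
    split_ifs with he
    · refine (integral_exp_neg_le hρ_mgf (by positivity) hN).trans ?_
      exact le_mul_of_one_le_left (Real.exp_pos _).le (Real.one_le_exp (by positivity))
    · rw [mul_one]
      refine integral_exp_le hρ_even hρ_mgf hN ?_
      rw [abs_div, abs_mul, abs_of_pos hβ, abs_of_nonneg (Real.sqrt_nonneg _), mul_comm 2 β]
      gcongr
      exact abs_spin_sum_le σ τ e
  have hcard : (Fintype.card (Bond N) : ℝ) ≤ N * N := by
    have h : Fintype.card (Bond N) ≤ Fintype.card (Fin N × Fin N) := Fintype.card_subtype_le _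
    rw [Fintype.card_prod, Fintype.card_fin] at h
    exact_mod_cast h
  calc ∏ e, ∫ x, bondFactor β E σ τ e x ∂ρ
      ≤ ∏ e, (Real.exp (C / N) * if e ∈ E then Real.exp (-(c / √N)) else 1) :=
        Finset.prod_le_prod (fun e _ => integral_nonneg fun x => (bondFactor_pos β E σ τ e x).le)
          fun e _ => hbond e
    _ = Real.exp (Fintype.card (Bond N) * (C / N)) * Real.exp (E.card * -(c / √N)) := by
        rw [Finset.prod_mul_distrib, Finset.prod_const, Finset.card_univ, Finset.prod_ite_mem,
          Finset.univ_inter, Finset.prod_const, Real.exp_nat_mul, Real.exp_nat_mul]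
    _ ≤ Real.exp (N * N * (C / N)) * Real.exp (E.card * -(c / √N)) := by gcongr
    _ = _ := by
        rw [← Real.exp_add]
        congr 1
        field_simp
        ring

/-- The factor `4 ^ N` from the sum over the two replicas is cancelled by the lower bound on the
partition function. -/
theorem law_notBlueEvent_le (hρ_even : ρ.map (fun x => -x) = ρ)
    (hρ_mgf : ∀ t : ℝ, Integrable (fun x => Real.exp (t * x)) ρ) {β : ℝ} (hβ : 0 < β)
    (hN : 1 ≤ N) (E : Finset (Bond N)) :
    law ρ β N (notBlueEvent β E) ≤
      ENNReal.ofReal (Real.exp ((2 * β) ^ 2 * (∫ x, |x| ^ 2 * Real.exp (2 * β * |x|) ∂ρ) * N -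
        (∫ x, 2 * β * (|x| ^ 1 * Real.exp (-(2 * β) * |x|)) ∂ρ) * E.card / √N)) := by
  set R := Real.exp ((2 * β) ^ 2 * (∫ x, |x| ^ 2 * Real.exp (2 * β * |x|) ∂ρ) * N -
        (∫ x, 2 * β * (|x| ^ 1 * Real.exp (-(2 * β) * |x|)) ∂ρ) * E.card / √N)
  have hdens : Measurable fun x : (Bond N → ℝ) × Spins N × Spins N =>
      ENNReal.ofReal (gibbs β x.1 x.2.1 * gibbs β x.1 x.2.2) :=
    measurable_from_prod_countable_left fun p =>
      ((measurable_gibbs β p.1).mul (measurable_gibbs β p.2)).ennreal_ofReal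
  have hfac : Measurable fun x : (Bond N → ℝ) × Spins N × Spins N =>
      ENNReal.ofReal ((4 ^ N)⁻¹ * ∏ e, bondFactor β E x.2.1 x.2.2 e (x.1 e)) := by
    refine measurable_from_prod_countable_left fun p => Measurable.ennreal_ofReal ?_
    refine Measurable.const_mul (Finset.measurable_prod _ fun e _ => ?_) _
    unfold bondFactor
    split_ifs <;> fun_prop
  have hK : ∀ p : Spins N × Spins N,
      ∫⁻ K, ENNReal.ofReal ((4 ^ N)⁻¹ * ∏ e, bondFactor β E p.1 p.2 e (K e))
        ∂(Measure.pi fun _ : Bond N => ρ) ≤ ENNReal.ofReal ((4 ^ N)⁻¹ * R) := by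
    intro p
    have hint : Integrable (fun K : Bond N → ℝ => ∏ e, bondFactor β E p.1 p.2 e (K e))
        (Measure.pi fun _ : Bond N => ρ) :=
      Integrable.fintype_prod fun e => integrable_bondFactor hρ_mgf hβ E p.1 p.2 e
    rw [← ofReal_integral_eq_lintegral_ofReal (hint.const_mul _) (Eventually.of_forall fun K =>
      mul_nonneg (by positivity)
        (Finset.prod_nonneg fun e _ => (bondFactor_pos β E p.1 p.2 e _).le)),
      integral_const_mul, integral_fintype_prod_eq_prod]
    gcongr
    exact prod_integral_bondFactor_le hρ_even hρ_mgf hβ hN E p.1 p.2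
  have hcount : (Measure.count : Measure (Spins N)) Set.univ = 2 ^ N := by
    rw [Measure.count_univ]
    simp
  calc law ρ β N (notBlueEvent β E)
      = ∫⁻ x, ((Measure.pi fun _ : Bond N => expMeasure 1).prod
          (Measure.pi fun _ : Bond N => expMeasure 1)) (Prod.mk x ⁻¹' notBlueEvent β E)
          ∂(replicaLaw ρ β N) := Measure.prod_apply (measurableSet_notBlueEvent β E)
    _ ≤ ∫⁻ x, ENNReal.ofReal ((4 ^ N)⁻¹ * ∏ e, bondFactor β E x.2.1 x.2.2 e (x.1 e))
          ∂((Measure.pi fun _ : Bond N => ρ).prod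
            ((Measure.count : Measure (Spins N)).prod (Measure.count : Measure (Spins N)))) :=
        (lintegral_withDensity_le_lintegral_mul _ hdens _).trans
          (lintegral_mono fun x => density_mul_measure_section_le hβ E x)
    _ ≤ ∫⁻ _, ENNReal.ofReal ((4 ^ N)⁻¹ * R)
          ∂((Measure.count : Measure (Spins N)).prod (Measure.count : Measure (Spins N))) := by
        rw [lintegral_prod_symm _ hfac.aemeasurable]
        exact lintegral_mono hK
    _ = ENNReal.ofReal R := by
        rw [lintegral_const, ← Set.univ_prod_univ, Measure.prod_prod, hcount]
        have h4 : (2 : ENNReal) ^ N * 2 ^ N = ENNReal.ofReal (4 ^ N) := by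
          rw [← mul_pow, ENNReal.ofReal_pow (by norm_num)]
          norm_num
        rw [h4, ← ENNReal.ofReal_mul (by positivity)]
        congr 1
        field_simp

end NotBlue

/-! ### Cuts without blue bonds are unlikely -/

section Cuts

variable {N : ℕ}

/-- The bonds between `S` and `T`. -/
def cut (S T : Finset (Fin N)) : Finset (Bond N) :=
  Finset.univ.filter fun e => e.1.1 ∈ S ∧ e.1.2 ∈ T ∨ e.1.1 ∈ T ∧ e.1.2 ∈ S

theorem card_mul_card_le_card_cut {S T : Finset (Fin N)} (h : Disjoint S T) :
    S.card * T.card ≤ (cut S T).card := by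
  rw [← Finset.card_product]
  refine (Finset.card_le_card (t := (cut S T).image fun e =>
    if e.1.1 ∈ S then (e.1.1, e.1.2) else (e.1.2, e.1.1)) ?_).trans Finset.card_image_le
  rintro ⟨i, j⟩ hij
  obtain ⟨hi, hj⟩ := Finset.mem_product.1 hij
  have hjS : j ∉ S := fun hjS => Finset.disjoint_left.1 h hjS hj
  have hne : i ≠ j := fun hij => hjS (hij ▸ hi)
  rw [Finset.mem_image]
  rcases lt_or_gt_of_ne hne with hlt | hlt
  · exact ⟨⟨(i, j), hlt⟩, by simp [cut, hi, hj], by simp_all⟩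
  · exact ⟨⟨(j, i), hlt⟩, by simp [cut, hi, hj], by simp_all⟩

/-- The event that, for some disjoint sets `S` and `T` of at least `m` sites each, the replicas
agree on all the bonds between `S` and `T`, but none of these bonds is blue. -/
def badCutEvent (β : ℝ) (N m : ℕ) : Set (Sample N) :=
  {ω | ∃ S T : Finset (Fin N), Disjoint S T ∧ m ≤ S.card ∧ m ≤ T.card ∧
    ω ∈ notBlueEvent β (cut S T)}

/-- For `m` of order `N` the energy term is of order `N ^ (3 / 2)` and beats the entropy of the
`4 ^ N` pairs of sets. -/
theorem law_badCutEvent_le {ρ : Measure ℝ} [IsProbabilityMeasure ρ]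
    (hρ_even : ρ.map (fun x => -x) = ρ)
    (hρ_mgf : ∀ t : ℝ, Integrable (fun x => Real.exp (t * x)) ρ) {β : ℝ} (hβ : 0 < β)
    (hN : 1 ≤ N) (m : ℕ) :
    law ρ β N (badCutEvent β N m) ≤ ENNReal.ofReal (Real.exp (
      (Real.log 4 + (2 * β) ^ 2 * ∫ x, |x| ^ 2 * Real.exp (2 * β * |x|) ∂ρ) * N -
        (∫ x, 2 * β * (|x| ^ 1 * Real.exp (-(2 * β) * |x|)) ∂ρ) * m ^ 2 / √N)) := by
  classical
  set C := (2 * β) ^ 2 * ∫ x, |x| ^ 2 * Real.exp (2 * β * |x|) ∂ρ with hC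
  set c := ∫ x, 2 * β * (|x| ^ 1 * Real.exp (-(2 * β) * |x|)) ∂ρ with hc
  have hc0 : 0 ≤ c := integral_nonneg fun x => by positivity
  let P : Finset (Finset (Fin N) × Finset (Fin N)) := Finset.univ.filter fun p =>
    Disjoint p.1 p.2 ∧ m ≤ p.1.card ∧ m ≤ p.2.card
  have hsub : badCutEvent β N m ⊆ ⋃ p ∈ P, notBlueEvent β (cut p.1 p.2) := by
    rintro ω ⟨S, T, hST, hS, hT, hω⟩
    simp only [Set.mem_iUnion]
    exact ⟨(S, T), by simp [P, hST, hS, hT], hω⟩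
  have hterm : ∀ p ∈ P, law ρ β N (notBlueEvent β (cut p.1 p.2)) ≤
      ENNReal.ofReal (Real.exp (C * N - c * m ^ 2 / √N)) := by
    intro p hp
    obtain ⟨hdisj, h₁, h₂⟩ := (Finset.mem_filter.1 hp).2
    have hcard : (m : ℝ) ^ 2 ≤ (cut p.1 p.2).card := by
      have h := (Nat.mul_le_mul h₁ h₂).trans (card_mul_card_le_card_cut hdisj)
      rw [sq]
      exact_mod_cast h
    refine (law_notBlueEvent_le hρ_even hρ_mgf hβ hN _).trans ?_
    rw [← hC, ← hc]
    gcongr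
  have hP : (P.card : ENNReal) ≤ ENNReal.ofReal (4 ^ N) := by
    have h : P.card ≤ 4 ^ N := by
      refine (Finset.card_le_univ P).trans_eq ?_
      rw [Fintype.card_prod, Fintype.card_finset, Fintype.card_fin, ← mul_pow]
      norm_num
    rw [← ENNReal.ofReal_natCast]
    exact ENNReal.ofReal_le_ofReal (by exact_mod_cast h)
  calc law ρ β N (badCutEvent β N m)
      ≤ ∑ p ∈ P, law ρ β N (notBlueEvent β (cut p.1 p.2)) :=
        (measure_mono hsub).trans (measure_biUnion_finset_le _ _)
    _ ≤ P.card • ENNReal.ofReal (Real.exp (C * N - c * m ^ 2 / √N)) :=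
        Finset.sum_le_card_nsmul _ _ _ hterm
    _ ≤ ENNReal.ofReal (4 ^ N) * ENNReal.ofReal (Real.exp (C * N - c * m ^ 2 / √N)) := by
        rw [nsmul_eq_mul]
        gcongr
    _ = _ := by
        rw [← ENNReal.ofReal_mul (by positivity)]
        have h4 : (4 : ℝ) ^ N = Real.exp (N * Real.log 4) := by
          rw [Real.exp_nat_mul, Real.exp_log (by norm_num)]
        rw [h4, ← Real.exp_add]
        ring_nf

/-- The event that some coupling vanishes. -/
def zeroCouplingEvent (N : ℕ) : Set (Sample N) := {ω | ∃ e, ω.1.1 e = 0}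

theorem law_zeroCouplingEvent {ρ : Measure ℝ} [IsProbabilityMeasure ρ] (hρ_zero : ρ {0} = 0)
    (β : ℝ) (N : ℕ) : law ρ β N (zeroCouplingEvent N) = 0 := by
  have hsub : zeroCouplingEvent N = ⋃ e : Bond N,
      (((Function.eval e ⁻¹' {(0 : ℝ)} : Set (Bond N → ℝ)) ×ˢ
        (Set.univ : Set (Spins N × Spins N))) ×ˢ
          (Set.univ : Set ((Bond N → ℝ) × (Bond N → ℝ)))) := by
    ext ω
    simp [zeroCouplingEvent]
  rw [hsub, measure_iUnion_null_iff]
  intro e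
  have h0 : (Measure.pi fun _ : Bond N => ρ) (Function.eval e ⁻¹' {(0 : ℝ)}) = 0 :=
    Measure.pi_eval_preimage_null _ hρ_zero
  have h1 : replicaLaw ρ β N ((Function.eval e ⁻¹' {(0 : ℝ)} : Set (Bond N → ℝ)) ×ˢ
        (Set.univ : Set (Spins N × Spins N))) = 0 := by
    refine withDensity_absolutelyContinuous _ _ ?_
    rw [Measure.prod_prod, h0, zero_mul]
  rw [law]
  have : SFinite (replicaLaw ρ β N) := by
    unfold replicaLaw
    infer_instance
  rw [Measure.prod_prod, h1, zero_mul]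

end Cuts

/-! ### Blue clusters outside the bad events -/

section BlueClusters

variable {N : ℕ} {β : ℝ} {ω : Sample N}

theorem coupling_ne_zero {K : Bond N → ℝ} {e : Bond N} (h : K e ≠ 0) : coupling K e ≠ 0 := by
  have hN : (0 : ℝ) < N := by exact_mod_cast Fin.pos e.1.1
  exact div_ne_zero h (Real.sqrt_pos.2 hN).ne'

theorem Blue.agree {e : Bond N} (h : Blue β ω e) (hK : ω.1.1 e ≠ 0) :
    Agree ω.1.2.1 ω.1.2.2 e := by
  obtain ⟨h₁, h₂, -⟩ := h
  have hJ := coupling_ne_zero hK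
  rw [Satisfied, not_lt, bondTerm, mul_assoc] at h₁ h₂
  unfold Agree
  rcases bond_spin_eq_or ω.1.2.1 e with hs | hs <;> rcases bond_spin_eq_or ω.1.2.2 e with ht | ht <;>
    rw [hs] at h₁ ⊢ <;> rw [ht] at h₂ ⊢ <;> exact (hJ (by linarith)).elim

theorem blueGraph_adj {i j : Fin N} (h : (blueGraph β ω).Adj i j) :
    (∃ hij : i < j, Blue β ω ⟨(i, j), hij⟩) ∨ ∃ hji : j < i, Blue β ω ⟨(j, i), hji⟩ :=
  ((SimpleGraph.fromRel_adj _ _ _).1 h).2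

theorem blueGraph_adj_of_blue {e : Bond N} (h : Blue β ω e) :
    (blueGraph β ω).Adj e.1.1 e.1.2 :=
  (SimpleGraph.fromRel_adj _ _ _).2 ⟨e.2.ne, Or.inl ⟨e.2, h⟩⟩

theorem spin_mul_eq_of_adj (hK : ω ∉ zeroCouplingEvent N) {i j : Fin N}
    (h : (blueGraph β ω).Adj i j) :
    spin ω.1.2.1 i * spin ω.1.2.1 j = spin ω.1.2.2 i * spin ω.1.2.2 j := by
  have hK' : ∀ e, ω.1.1 e ≠ 0 := fun e he => hK ⟨e, he⟩
  rcases blueGraph_adj h with ⟨_, hb⟩ | ⟨_, hb⟩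
  · exact hb.agree (hK' _)
  · have := hb.agree (hK' _)
    unfold Agree at this
    linarith

/-- The sites on which the two replicas coincide. -/
def agreeSet (ω : Sample N) : Set (Fin N) := {i | ω.1.2.1 i = ω.1.2.2 i}

theorem spin_eq_of_mem {i : Fin N} (h : i ∈ agreeSet ω) : spin ω.1.2.1 i = spin ω.1.2.2 i := by
  have h : ω.1.2.1 i = ω.1.2.2 i := h
  rw [spin, spin, h]

theorem spin_eq_neg_of_notMem {i : Fin N} (h : i ∉ agreeSet ω) :
    spin ω.1.2.1 i = -spin ω.1.2.2 i := by
  have h : ω.1.2.1 i ≠ ω.1.2.2 i := h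
  rw [spin, spin, Int.units_ne_iff_eq_neg.1 h]
  simp

theorem noEdgeLeaves_agreeSet (hK : ω ∉ zeroCouplingEvent N) :
    NoEdgeLeaves (blueGraph β ω) (agreeSet ω) := by
  intro i hi j hij
  by_contra hj
  have h := spin_mul_eq_of_adj hK hij
  rw [spin_eq_of_mem hi, spin_eq_neg_of_notMem hj] at h
  rcases spin_eq_or ω.1.2.2 i with h₁ | h₁ <;> rcases spin_eq_or ω.1.2.2 j with h₂ | h₂ <;>
    rw [h₁, h₂] at h <;> norm_num at h

theorem unsplittable_of_agree {m : ℕ} (hω : ω ∉ badCutEvent β N m) {X : Set (Fin N)}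
    (hX : ∀ e : Bond N, e.1.1 ∈ X → e.1.2 ∈ X → Agree ω.1.2.1 ω.1.2.2 e) :
    Unsplittable (blueGraph β ω) m X := by
  classical
  intro S hSX hS
  by_contra! hm
  refine hω ⟨S.toFinset, (X \ S).toFinset, ?_, ?_, ?_, fun e he => ?_⟩
  · rw [Set.disjoint_toFinset]
    exact Set.disjoint_sdiff_right
  · rw [← Set.ncard_eq_toFinset_card']
    exact hm.1
  · rw [← Set.ncard_eq_toFinset_card']
    exact hm.2
  · simp only [cut, Finset.mem_filter, Finset.mem_univ, true_and, Set.mem_toFinset] at he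
    rcases he with ⟨h₁, h₂⟩ | ⟨h₁, h₂⟩
    · exact ⟨hX e (hSX h₁) h₂.1, fun hb => h₂.2 (hS _ h₁ _ (blueGraph_adj_of_blue hb))⟩
    · exact ⟨hX e h₁.1 (hSX h₂), fun hb => h₁.2 (hS _ h₂ _ (blueGraph_adj_of_blue hb).symm)⟩

theorem unsplittable_agreeSet {m : ℕ} (hω : ω ∉ badCutEvent β N m) :
    Unsplittable (blueGraph β ω) m (agreeSet ω) :=
  unsplittable_of_agree hω fun e h₁ h₂ => by
    rw [Agree, spin_eq_of_mem h₁, spin_eq_of_mem h₂]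

theorem unsplittable_compl_agreeSet {m : ℕ} (hω : ω ∉ badCutEvent β N m) :
    Unsplittable (blueGraph β ω) m (agreeSet ω)ᶜ :=
  unsplittable_of_agree hω fun e h₁ h₂ => by
    rw [Agree, spin_eq_neg_of_notMem h₁, spin_eq_neg_of_notMem h₂, neg_mul_neg]

theorem Q_eq : Q ω = (((agreeSet ω).ncard : ℝ) - (agreeSet ω)ᶜ.ncard) / N := by
  classical
  have h : ∀ i, spin ω.1.2.1 i * spin ω.1.2.2 i =
      (if i ∈ agreeSet ω then 1 else 0) - if i ∈ (agreeSet ω)ᶜ then 1 else 0 := by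
    intro i
    by_cases hi : i ∈ agreeSet ω
    · rw [spin_eq_of_mem hi, spin_mul_self]
      simp [hi]
    · rw [spin_eq_neg_of_notMem hi, neg_mul, spin_mul_self]
      simp [hi]
  rw [Q, Finset.sum_congr rfl fun i _ => h i, Finset.sum_sub_distrib, Finset.sum_boole,
    Finset.sum_boole, Set.ncard_eq_toFinset_card', Set.ncard_eq_toFinset_card', ← div_eq_inv_mul]
  congr 3 <;> congr 2 <;> ext <;> simp

/-- Outside the bad events, the densities of the three largest blue clusters are close to the
fractions of sites on which the replicas agree and disagree, and to zero. -/
theorem abs_D_sub_le (hN : 1 ≤ N) {m : ℕ} (hK : ω ∉ zeroCouplingEvent N)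
    (hω : ω ∉ badCutEvent β N m) :
    |D β 1 ω - (1 + |Q ω|) / 2| ≤ 3 * m / N ∧ |D β 2 ω - (1 - |Q ω|) / 2| ≤ 3 * m / N ∧
      |D β 3 ω| ≤ 3 * m / N := by
  have hN0 : (0 : ℝ) < N := by exact_mod_cast hN
  have key : ∀ A : Set (Fin N), NoEdgeLeaves (blueGraph β ω) A →
      Unsplittable (blueGraph β ω) m A → Unsplittable (blueGraph β ω) m Aᶜ →
      Aᶜ.ncard ≤ A.ncard → |Q ω| = ((A.ncard : ℝ) - Aᶜ.ncard) / N →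
      |D β 1 ω - (1 + |Q ω|) / 2| ≤ 3 * m / N ∧ |D β 2 ω - (1 - |Q ω|) / 2| ≤ 3 * m / N ∧
        |D β 3 ω| ≤ 3 * m / N := by
    intro A hA hU hU' hle hQ
    have hsum : A.ncard + Aᶜ.ncard = N := by
      rw [Set.ncard_add_ncard_compl, Nat.card_eq_fintype_card, Fintype.card_fin]
    have hne : A.Nonempty := Set.nonempty_of_ncard_ne_zero (by omega)
    obtain ⟨⟨h₁, h₂⟩, ⟨h₃, h₄⟩, h₅⟩ := clusterSize_of_unsplittable hA hU hU' hle hne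
    rify at hsum h₁ h₂ h₃ h₄ h₅
    have hm : (0 : ℝ) ≤ m := m.cast_nonneg
    have e₁ : D β 1 ω - (1 + |Q ω|) / 2 = (clusterSize (blueGraph β ω) 1 - A.ncard) / N := by
      rw [hQ, D, ← hsum]
      have : (A.ncard : ℝ) + Aᶜ.ncard ≠ 0 := by rw [hsum]; exact hN0.ne'
      field_simp
      ring
    have e₂ : D β 2 ω - (1 - |Q ω|) / 2 = (clusterSize (blueGraph β ω) 2 - Aᶜ.ncard) / N := by
      rw [hQ, D, ← hsum]
      have : (A.ncard : ℝ) + Aᶜ.ncard ≠ 0 := by rw [hsum]; exact hN0.ne'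
      field_simp
      ring
    rw [e₁, e₂, D, abs_div, abs_div, abs_div, abs_of_pos hN0]
    refine ⟨?_, ?_, ?_⟩ <;> gcongr <;> rw [abs_le] <;> constructor <;> linarith
  rcases le_total (agreeSet ω)ᶜ.ncard (agreeSet ω).ncard with hle | hle
  · refine key _ (noEdgeLeaves_agreeSet hK) (unsplittable_agreeSet hω)
      (unsplittable_compl_agreeSet hω) hle ?_
    rw [Q_eq, abs_of_nonneg]
    exact div_nonneg (sub_nonneg.2 (by exact_mod_cast hle)) hN0.le
  · refine key (agreeSet ω)ᶜ (noEdgeLeaves_agreeSet hK).compl (unsplittable_compl_agreeSet hω)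
      (by rw [compl_compl]; exact unsplittable_agreeSet hω) (by rwa [compl_compl]) ?_
    rw [Q_eq, compl_compl, abs_div, abs_sub_comm, abs_of_pos hN0, abs_of_nonneg]
    exact sub_nonneg.2 (by exact_mod_cast hle)

end BlueClusters

/-! ### The limit -/

section Limit

theorem tendsto_linear_sub_mul_sqrt (a : ℝ) {b : ℝ} (hb : 0 < b) :
    Tendsto (fun N : ℕ => a * N - b * (N * √(N : ℝ))) atTop atBot := by
  have hN : Tendsto (fun N : ℕ => (N : ℝ)) atTop atTop := tendsto_natCast_atTop_atTop
  have hs : Tendsto (fun N : ℕ => b * √(N : ℝ) - a) atTop atTop :=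
    tendsto_atTop_add_const_right _ _ ((Real.tendsto_sqrt_atTop.comp hN).const_mul_atTop hb)
  refine (tendsto_neg_atTop_atBot.comp (hN.atTop_mul_atTop₀ hs)).congr fun N => ?_
  simp only [Function.comp_apply]
  ring

theorem tendsto_law_badCutEvent {ρ : Measure ℝ} [IsProbabilityMeasure ρ]
    (hρ_even : ρ.map (fun x => -x) = ρ) (hρ_zero : ρ {0} = 0)
    (hρ_mgf : ∀ t : ℝ, Integrable (fun x => Real.exp (t * x)) ρ) {β : ℝ} (hβ : 0 < β)
    {δ : ℝ} (hδ : 0 < δ) :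
    Tendsto (fun N : ℕ => law ρ β N (badCutEvent β N ⌊δ * N⌋₊)) atTop (𝓝 0) := by
  set C := (2 * β) ^ 2 * ∫ x, |x| ^ 2 * Real.exp (2 * β * |x|) ∂ρ with hC
  set c := ∫ x, 2 * β * (|x| ^ 1 * Real.exp (-(2 * β) * |x|)) ∂ρ with hc
  have hc0 : 0 < c := integral_abs_mul_exp_neg_pos hρ_zero hρ_mgf (by positivity)
  have hlim : Tendsto (fun N : ℕ => ENNReal.ofReal (Real.exp
      ((Real.log 4 + C) * N - c * (δ / 2) ^ 2 * (N * √(N : ℝ))))) atTop (𝓝 0) := by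
    rw [← ENNReal.ofReal_zero]
    exact (ENNReal.continuous_ofReal.tendsto 0).comp (Real.tendsto_exp_atBot.comp
      (tendsto_linear_sub_mul_sqrt _ (by positivity)))
  refine tendsto_of_tendsto_of_tendsto_of_le_of_le' tendsto_const_nhds hlim
    (Eventually.of_forall fun _ => zero_le) ?_
  filter_upwards [eventually_ge_atTop 1, eventually_ge_atTop ⌈2 / δ⌉₊] with N hN1 hN2
  have hN0 : (0 : ℝ) < N := by exact_mod_cast hN1
  refine (law_badCutEvent_le hρ_even hρ_mgf hβ hN1 _).trans ?_
  rw [← hC, ← hc]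
  have hfloor : δ / 2 * N ≤ (⌊δ * N⌋₊ : ℝ) := by
    have h₁ := Nat.lt_floor_add_one (δ * N)
    have h₂ : 2 ≤ δ * N := by
      have := (div_le_iff₀ hδ).1 (Nat.ceil_le.1 hN2)
      linarith
    linarith
  have hsq : (δ / 2) ^ 2 * (N * √(N : ℝ)) ≤ (⌊δ * N⌋₊ : ℝ) ^ 2 / √N := by
    rw [le_div_iff₀ (Real.sqrt_pos.2 hN0)]
    calc (δ / 2) ^ 2 * (N * √(N : ℝ)) * √N = (δ / 2 * N) ^ 2 * (√(N : ℝ) * √N / N) := by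
          field_simp
      _ = (δ / 2 * N) ^ 2 := by rw [Real.mul_self_sqrt hN0.le, div_self hN0.ne', mul_one]
      _ ≤ _ := by gcongr
  have h := mul_le_mul_of_nonneg_left hsq hc0.le
  gcongr
  calc _ = c * ((δ / 2) ^ 2 * (N * √(N : ℝ))) := by ring
    _ ≤ _ := h
    _ = _ := by ring

/-- A sequence of random variables that is at most `3 m / N` outside the bad events tends to zero in
probability. -/
theorem tendstoZeroInProbability_of_abs_le {ρ : Measure ℝ} [IsProbabilityMeasure ρ]
    (hρ_even : ρ.map (fun x => -x) = ρ) (hρ_zero : ρ {0} = 0)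
    (hρ_mgf : ∀ t : ℝ, Integrable (fun x => Real.exp (t * x)) ρ) {β : ℝ} (hβ : 0 < β)
    {X : ∀ N, Sample N → ℝ}
    (hX : ∀ (N m : ℕ) (ω : Sample N), 1 ≤ N → ω ∉ zeroCouplingEvent N → ω ∉ badCutEvent β N m →
      |X N ω| ≤ 3 * m / N) :
    TendstoZeroInProbability (fun N => law ρ β N) X := by
  intro ε hε
  refine tendsto_of_tendsto_of_tendsto_of_le_of_le' tendsto_const_nhds
    (tendsto_law_badCutEvent hρ_even hρ_zero hρ_mgf hβ (δ := ε / 3) (by positivity))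
    (Eventually.of_forall fun _ => zero_le) ?_
  filter_upwards [eventually_ge_atTop 1] with N hN
  have hN0 : (0 : ℝ) < N := by exact_mod_cast hN
  have hsub : {ω | ε < |X N ω|} ⊆ zeroCouplingEvent N ∪ badCutEvent β N ⌊ε / 3 * N⌋₊ := by
    intro ω hω
    by_contra hnot
    rw [Set.mem_union, not_or] at hnot
    have h := hX N _ ω hN hnot.1 hnot.2
    have hfl : (⌊ε / 3 * N⌋₊ : ℝ) ≤ ε / 3 * N := Nat.floor_le (by positivity)
    have h' : 3 * (⌊ε / 3 * N⌋₊ : ℝ) / N ≤ ε := by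
      rw [div_le_iff₀ hN0]
      linarith
    have hω : ε < |X N ω| := hω
    linarith
  calc law ρ β N {ω | ε < |X N ω|}
      ≤ law ρ β N (zeroCouplingEvent N) + law ρ β N (badCutEvent β N ⌊ε / 3 * N⌋₊) :=
        (measure_mono hsub).trans (measure_union_le _ _)
    _ = _ := by rw [law_zeroCouplingEvent hρ_zero, zero_add]

end Limit

end SK

theorem theorem1 (ρ : Measure ℝ) [IsProbabilityMeasure ρ]
    (hρ_even : ρ.map (fun x => -x) = ρ)
    (hρ_zero : ρ {0} = 0)
    (hρ_var : ∫ x, x ^ 2 ∂ρ = 1)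
    (hρ_mgf : ∀ t : ℝ, Integrable (fun x => Real.exp (t * x)) ρ)
    (β : ℝ) (hβ : 0 < β) :
    SK.TendstoZeroInProbability (fun N => SK.law ρ β N)
        (fun _ ω => SK.D β 1 ω - (1 + |SK.Q ω|) / 2) ∧
      SK.TendstoZeroInProbability (fun N => SK.law ρ β N)
        (fun _ ω => SK.D β 2 ω - (1 - |SK.Q ω|) / 2) ∧
      SK.TendstoZeroInProbability (fun N => SK.law ρ β N)
        (fun _ ω => SK.D β 3 ω) := by
  refine ⟨?_, ?_, ?_⟩ <;>
    refine SK.tendstoZeroInProbability_of_abs_le hρ_even hρ_zero hρ_mgf hβ fun N m ω hN hK hω => ?_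
  · exact (SK.abs_D_sub_le hN hK hω).1
  · exact (SK.abs_D_sub_le hN hK hω).2.1
  · exact (SK.abs_D_sub_le hN hK hω).2.2
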